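/- Let $\mu_1,\mu_*>0$ and $F_1,F_*,\tau\in\mathbb{R}$, and put $\zeta=\mu_1/\mu_*$. For $\psi_1,\psi_2>0$ let $\nu_1,\nu_2:\mathbb{C}_+\to\mathbb{C}_+$ (with $\mathbb{C}_+$ the open upper half plane) be the functions determined by the following conditions: they are analytic on $\mathbb{C}_+$; for every $\xi\in\mathbb{C}_+$ they satisfy $$\nu_1=\psi_1\Bigl(-\xi-\nu_2-\frac{\zeta^2\nu_2}{1-\zeta^2\nu_1\nu_2}\Bigr)^{-1},\qquad \nu_2=\psi_2\Bigl(-\xi-\nu_1-\frac{\zeta^2\nu_1}{1-\zeta^2\nu_1\nu_2}\Bigr)^{-1};$$ and there is a constant $C>0$ such that, whenever $\operatorname{Im}\xi>C$, the pair $(\nu_1(\xi),\nu_2(\xi))$ is the unique solution of these equations in $\mathbb{C}^2$ with $|\nu_1|\le\psi_1/\operatorname{Im}\xi$ and $|\nu_2|\le\psi_2/\operatorname{Im}\xi$. For $\lambda>0$ define $$\chi=\nu_1\Bigl(\tfrac{i\sqrt{\psi_1\psi_2\lambda}}{\mu_*}\Bigr)\,\nu_2\Bigl(\tfrac{i\sqrt{\psi_1\psi_2\lambda}}{\mu_*}\Bigr),\qquad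 \mathcal{S}^2(\psi_1,\psi_2,\lambda)=\frac{F_1^2}{1-\chi\zeta^2}+F_*^2+\tau^2 .$$ ($\mathcal{S}^2$ is the asymptotic expected posterior predictive variance of the random features model with ridge parameter $\lambda$.) Then $\mathcal{S}^2$ is well defined: such a pair $(\nu_1,\nu_2)$ exists and is unique on $\mathbb{C}_+$, $1-\chi\zeta^2\neq0$, and $\mathcal{S}^2$ is a real number. Moreover: 1. For all $\psi_1,\psi_2>0$, the map $\lambda\mapsto\mathcal{S}^2(\psi_1,\psi_2,\lambda)$ is non-decreasing on $(0,\infty)$. 2. If $\psi_1=\psi_2>0$, the limit $\lim_{\lambda\to0^+}\mathcal{S}^2(\psi_1,\psi_2,\lambda)$ exists and is finite. -/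

import Mathlib

open Set Filter Topology

/-- The open upper half plane, as a subset of `ℂ`. -/
def upperHalf : Set ℂ := {ξ : ℂ | 0 < ξ.im}

/-- The pair `(z₁, z₂)` satisfies the two coupled fixed point equations at the point `ξ`. -/
def FixedPointEqs (ψ₁ ψ₂ ζ : ℝ) (ξ z₁ z₂ : ℂ) : Prop :=
  z₁ = (ψ₁ : ℂ) * (-ξ - z₂ - (ζ : ℂ) ^ 2 * z₂ / (1 - (ζ : ℂ) ^ 2 * z₁ * z₂))⁻¹ ∧
  z₂ = (ψ₂ : ℂ) * (-ξ - z₁ - (ζ : ℂ) ^ 2 * z₁ / (1 - (ζ : ℂ) ^ 2 * z₁ * z₂))⁻¹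

/-- The conditions that characterize the pair of functions `ν = (ν₁, ν₂)` on the upper half plane.
The values outside the upper half plane are irrelevant. -/
structure IsNuPair (ψ₁ ψ₂ ζ : ℝ) (ν : (ℂ → ℂ) × (ℂ → ℂ)) : Prop where
  mapsTo_fst : MapsTo ν.1 upperHalf upperHalf
  mapsTo_snd : MapsTo ν.2 upperHalf upperHalf
  analytic_fst : AnalyticOnNhd ℂ ν.1 upperHalf
  analytic_snd : AnalyticOnNhd ℂ ν.2 upperHalf
  eqs : ∀ ξ ∈ upperHalf, FixedPointEqs ψ₁ ψ₂ ζ ξ (ν.1 ξ) (ν.2 ξ)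
  /-- For large imaginary part, `(ν₁ ξ, ν₂ ξ)` is the unique solution of the equations within the
  bounds `|z₁| ≤ ψ₁ / Im ξ`, `|z₂| ≤ ψ₂ / Im ξ`. -/
  unique_large : ∃ C : ℝ, 0 < C ∧ ∀ ξ : ℂ, C < ξ.im →
    (‖ν.1 ξ‖ ≤ ψ₁ / ξ.im ∧ ‖ν.2 ξ‖ ≤ ψ₂ / ξ.im) ∧
    ∀ z₁ z₂ : ℂ, FixedPointEqs ψ₁ ψ₂ ζ ξ z₁ z₂ → ‖z₁‖ ≤ ψ₁ / ξ.im → ‖z₂‖ ≤ ψ₂ / ξ.im →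
      z₁ = ν.1 ξ ∧ z₂ = ν.2 ξ

/-- The pair `(ν₁, ν₂)`; on the upper half plane it is determined by `IsNuPair`. -/
noncomputable def nuPair (ψ₁ ψ₂ ζ : ℝ) : (ℂ → ℂ) × (ℂ → ℂ) :=
  Classical.epsilon (IsNuPair ψ₁ ψ₂ ζ)

/-- `χ = ν₁(i √(ψ₁ψ₂λ) / μ⋆) ν₂(i √(ψ₁ψ₂λ) / μ⋆)`, with `ζ = μ₁ / μ⋆`. -/
noncomputable def chi (μ₁ μs ψ₁ ψ₂ lam : ℝ) : ℂ :=
  (nuPair ψ₁ ψ₂ (μ₁ / μs)).1 (Complex.I * ((Real.sqrt (ψ₁ * ψ₂ * lam) / μs : ℝ) : ℂ)) *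
  (nuPair ψ₁ ψ₂ (μ₁ / μs)).2 (Complex.I * ((Real.sqrt (ψ₁ * ψ₂ * lam) / μs : ℝ) : ℂ))

/-- The formula `F₁² / (1 - χ ζ²) + F⋆² + τ²`, as a complex number. -/
noncomputable def limitPPVComplex (μ₁ μs F₁ Fs τ ψ₁ ψ₂ lam : ℝ) : ℂ :=
  (F₁ : ℂ) ^ 2 / (1 - chi μ₁ μs ψ₁ ψ₂ lam * ((μ₁ / μs : ℝ) : ℂ) ^ 2) + (Fs : ℂ) ^ 2 + (τ : ℂ) ^ 2

/-- The limiting expected posterior predictive variance `𝒮²(ψ₁, ψ₂, λ)`, a real number. -/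
noncomputable def limitPPV (μ₁ μs F₁ Fs τ ψ₁ ψ₂ lam : ℝ) : ℝ :=
  (limitPPVComplex μ₁ μs F₁ Fs τ ψ₁ ψ₂ lam).re

/-!
For large `Im ξ` the right hand side of the equations is a contraction on a small polydisc, so its
Picard iterates converge there. On the whole upper half plane the iterates are holomorphic and
bounded by `(ψ₁ + ψ₂) / Im ξ`, so Vitali's theorem propagates the convergence. The iterates lie in
discs tangent to the real axis at `0`; a limit `0` is excluded by the equations, so the limits are
in the open upper half plane. Uniqueness for large `Im ξ` extends by the identity theorem.

By uniqueness `ν` commutes with the reflection `ξ ↦ -conj ξ`, so `ν₁ (i s) = i p`, `ν₂ (i s) = i r`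
with `p, r > 0`. The equations become `s p = ψ₁ - G (p r)`, `s r = ψ₂ - G (p r)` with `G` strictly
increasing. If `p r` increased with `s`, then `p` and `r` would both decrease, a contradiction.
Hence `-χ = p r` is non-increasing in `λ`, and `𝒮²` is non-decreasing and non-negative, which
gives the limit at `0` as well.
-/

section Vitali

variable {E : Type*} [NormedAddCommGroup E] [NormedSpace ℂ E]

theorem dist_add_exp (c w : ℂ) : dist (c + Complex.exp w) c = Real.exp w.re := by
  rw [dist_self_add_left, Complex.norm_exp]

theorem mapsTo_add_exp_verticalStrip (c : ℂ) {r R : ℝ} (hr : 0 < r) (hR : 0 < R) :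
    MapsTo (fun w => c + Complex.exp w)
      (Complex.HadamardThreeLines.verticalStrip (Real.log r) (Real.log R))
      (Metric.ball c R \ Metric.closedBall c r) := by
  intro w hw
  rw [Set.mem_sdiff, Metric.mem_ball, Metric.mem_closedBall, dist_add_exp, not_le,
    ← Real.log_lt_iff_lt_exp hr, ← Real.lt_log_iff_exp_lt hR]
  exact hw.symm

theorem mapsTo_add_exp_verticalClosedStrip (c : ℂ) {r R : ℝ} (hr : 0 < r) (hrR : r < R) :
    MapsTo (fun w => c + Complex.exp w)
      (Complex.HadamardThreeLines.verticalClosedStrip (Real.log r) (Real.log R))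
      (closure (Metric.ball c R \ Metric.closedBall c r)) := by
  have h := (mapsTo_add_exp_verticalStrip c hr (hr.trans hrR)).closure (by fun_prop)
  rwa [Complex.HadamardThreeLines.verticalStrip, Complex.closure_preimage_re,
    closure_Ioo (Real.log_lt_log hr hrR).ne] at h

-- Three circles is three lines for `w ↦ f (c + exp w)`.
theorem norm_le_rpow_mul_rpow_of_annulus {f : ℂ → E} {c z : ℂ} {r R A B : ℝ} (hr : 0 < r)
    (hrR : r < R) (hf : DiffContOnCl ℂ f (Metric.ball c R \ Metric.closedBall c r))
    (hA : ∀ w ∈ Metric.sphere c r, ‖f w‖ ≤ A) (hB : ∀ w ∈ Metric.sphere c R, ‖f w‖ ≤ B)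
    (hrz : r ≤ dist z c) (hzR : dist z c ≤ R) :
    ‖f z‖ ≤ A ^ (1 - Real.log (dist z c / r) / Real.log (R / r)) *
      B ^ (Real.log (dist z c / r) / Real.log (R / r)) := by
  have hR : 0 < R := hr.trans hrR
  have hz : 0 < dist z c := hr.trans_le hrz
  set e : ℂ → ℂ := fun w => c + Complex.exp w
  have he : Differentiable ℂ e := by fun_prop
  have hbdd : BddAbove ((norm ∘ f ∘ e) ''
      Complex.HadamardThreeLines.verticalClosedStrip (Real.log r) (Real.log R)) := by
    have hcompact : IsCompact (closure (Metric.ball c R \ Metric.closedBall c r)) :=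
      (Metric.isBounded_ball.subset sdiff_subset).isCompact_closure
    refine (hcompact.bddAbove_image hf.continuousOn.norm).mono ?_
    rw [← Function.comp_assoc, image_comp]
    exact image_mono (mapsTo_add_exp_verticalClosedStrip c hr hrR).image_subset
  obtain ⟨w, hw⟩ : ∃ w, Complex.exp w = z - c :=
    ⟨_, Complex.exp_log (sub_ne_zero.2 (dist_pos.1 hz))⟩
  have hez : e w = z := by simp only [e, hw, add_sub_cancel]
  have hre : w.re = Real.log (dist z c) := by
    rw [← hez, dist_add_exp, Real.log_exp]
  have key := Complex.HadamardThreeLines.norm_le_interp_of_mem_verticalClosedStrip'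
    (f := f ∘ e) (z := w) (a := A) (b := B) (Real.log_lt_log hr hrR)
    ⟨hre ▸ Real.log_le_log hr hrz, hre ▸ Real.log_le_log hz hzR⟩
    (hf.comp he.diffContOnCl (mapsTo_add_exp_verticalStrip c hr hR)) hbdd
    (fun u hu => hA _ (by
      rw [Metric.mem_sphere, dist_add_exp, show u.re = _ from hu, Real.exp_log hr]))
    (fun u hu => hB _ (by
      rw [Metric.mem_sphere, dist_add_exp, show u.re = _ from hu, Real.exp_log hR]))
  rwa [Function.comp_apply, hez, hre, ← Real.log_div hz.ne' hr.ne',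
    ← Real.log_div hR.ne' hr.ne'] at key

theorem norm_le_rpow_mul_rpow_of_mem_closedBall {f : ℂ → E} {c z : ℂ} {r ρ R A B : ℝ} (hr : 0 < r)
    (hrρ : r ≤ ρ) (hρR : ρ < R) (hf : DiffContOnCl ℂ f (Metric.ball c R))
    (hA : ∀ w ∈ Metric.sphere c r, ‖f w‖ ≤ A) (hB : ∀ w ∈ Metric.sphere c R, ‖f w‖ ≤ B)
    (hz : z ∈ Metric.closedBall c ρ) :
    ‖f z‖ ≤ A ^ (1 - Real.log (ρ / r) / Real.log (R / r)) *
      B ^ (Real.log (ρ / r) / Real.log (R / r)) := by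
  have hρ : ρ ≠ 0 := (hr.trans_le hrρ).ne'
  refine Complex.norm_le_of_forall_mem_frontier_norm_le Metric.isBounded_ball
    (hf.mono (Metric.ball_subset_ball hρR.le)) (fun w hw => ?_) (closure_ball c hρ ▸ hz)
  have hwρ : dist w c = ρ := by rwa [frontier_ball c hρ] at hw
  rw [← hwρ] at hrρ hρR ⊢
  exact norm_le_rpow_mul_rpow_of_annulus hr (hrρ.trans_lt hρR) (hf.mono sdiff_subset) hA hB hrρ
    hρR.le

variable {ι : Type*} {p : Filter ι} {f : ι → ℂ → E}

theorem uniformCauchySeqOn_closedBall_of_sphere {c : ℂ} {r ρ R M : ℝ} (hr : 0 < r) (hrρ : r ≤ ρ)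
    (hρR : ρ < R) (hf : ∀ i, DiffContOnCl ℂ (f i) (Metric.ball c R))
    (hM : ∀ i, ∀ z ∈ Metric.sphere c R, ‖f i z‖ ≤ M)
    (hC : UniformCauchySeqOn f p (Metric.sphere c r)) :
    UniformCauchySeqOn f p (Metric.closedBall c ρ) := by
  intro u hu
  obtain ⟨ε, hε, hεu⟩ := Metric.mem_uniformity_dist.1 hu
  set θ := Real.log (ρ / r) / Real.log (R / r)
  have hθ : 0 < 1 - θ := by
    rw [sub_pos, div_lt_one (Real.log_pos ((one_lt_div hr).2 (hrρ.trans_lt hρR)))]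
    have := hr.trans_le hrρ
    gcongr
  obtain ⟨η, hηε, hη⟩ : ∃ η : ℝ, η ^ (1 - θ) * (M + M) ^ θ < ε ∧ 0 < η := by
    have hlim : Tendsto (fun η : ℝ => η ^ (1 - θ) * (M + M) ^ θ) (𝓝 0) (𝓝 0) := by
      simpa only [Real.zero_rpow hθ.ne', zero_mul] using
        ((Real.continuousAt_rpow_const 0 (1 - θ) (Or.inr hθ.le)).tendsto).mul_const ((M + M) ^ θ)
    exact ((hlim.mono_left nhdsWithin_le_nhds).eventually_lt_const hε |>.and
      (self_mem_nhdsWithin (s := Ioi 0))).exists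
  filter_upwards [hC _ (Metric.dist_mem_uniformity hη)] with m hm z hz
  refine hεu (lt_of_le_of_lt ?_ hηε)
  rw [dist_eq_norm, ← Pi.sub_apply]
  refine norm_le_rpow_mul_rpow_of_mem_closedBall hr hrρ hρR ((hf m.1).sub (hf m.2))
    (fun w hw => ?_) (fun w hw => ?_) hz
  · rw [Pi.sub_apply, ← dist_eq_norm]
    exact (hm w hw).le
  · exact (norm_sub_le _ _).trans (add_le_add (hM m.1 w hw) (hM m.2 w hw))

theorem exists_mem_nhds_uniformCauchySeqOn_of_isPreconnected {U : Set ℂ} {a z : ℂ} (hU : IsOpen U)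
    (hUc : IsPreconnected U) (hf : ∀ i, DifferentiableOn ℂ (f i) U)
    (hb : ∀ w ∈ U, ∃ M, ∀ᶠ v in 𝓝 w, ∀ i, ‖f i v‖ ≤ M) (ha : a ∈ U)
    (hC : ∃ V ∈ 𝓝 a, UniformCauchySeqOn f p V) (hz : z ∈ U) :
    ∃ V ∈ 𝓝 z, UniformCauchySeqOn f p V := by
  let S : Set ℂ := {w | ∃ V ∈ 𝓝 w, UniformCauchySeqOn f p V}
  have hS : IsOpen S := isOpen_iff_mem_nhds.2 fun w ⟨V, hV, hVC⟩ => by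
    filter_upwards [eventually_mem_nhds_iff.2 hV] with v hv using ⟨V, hv, hVC⟩
  refine hUc.subset_of_closure_inter_subset hS ⟨a, ha, hC⟩ ?_ hz
  rintro w ⟨hwS, hwU⟩
  obtain ⟨M, hM⟩ := hb w hwU
  obtain ⟨R, hR, hball⟩ := Metric.nhds_basis_closedBall.mem_iff.1
    ((hU.eventually_mem hwU).and hM)
  have hR3 : 0 < R / 3 := by positivity
  obtain ⟨v, ⟨V, hV, hVC⟩, hwv⟩ := Metric.mem_closure_iff.1 hwS (R / 3) hR3
  have hsub : Metric.closedBall v (2 * (R / 3)) ⊆ Metric.closedBall w R :=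
    Metric.closedBall_subset_closedBall' (by rw [dist_comm v w]; linarith)
  obtain ⟨r, hr, hrV⟩ := Metric.nhds_basis_closedBall.mem_iff.1 hV
  refine ⟨Metric.closedBall v (R / 3),
    mem_of_superset (Metric.isOpen_ball.mem_nhds hwv) Metric.ball_subset_closedBall,
    uniformCauchySeqOn_closedBall_of_sphere (r := min r (R / 3)) (R := 2 * (R / 3)) (M := M)
      (lt_min hr hR3) (min_le_right _ _) (by linarith) (fun i => ?_) (fun i u hu => ?_)
      (hVC.mono fun u hu => hrV ?_)⟩
  · exact ((hf i).mono fun u hu => (hball (hsub hu)).1).diffContOnCl_ball subset_rfl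
  · exact (hball (hsub (Metric.sphere_subset_closedBall hu))).2 i
  · exact Metric.closedBall_subset_closedBall (min_le_left _ _) (Metric.sphere_subset_closedBall hu)

theorem exists_tendstoLocallyUniformlyOn_of_isPreconnected [CompleteSpace E] [p.NeBot] {U : Set ℂ}
    {a : ℂ} (hU : IsOpen U) (hUc : IsPreconnected U) (hf : ∀ i, DifferentiableOn ℂ (f i) U)
    (hb : ∀ w ∈ U, ∃ M, ∀ᶠ v in 𝓝 w, ∀ i, ‖f i v‖ ≤ M) (ha : a ∈ U)
    (hC : ∃ V ∈ 𝓝 a, UniformCauchySeqOn f p V) :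
    ∃ g : ℂ → E, TendstoLocallyUniformlyOn f g p U := by
  have hcauchy (z : ℂ) (hz : z ∈ U) : ∃ V ∈ 𝓝 z, UniformCauchySeqOn f p V :=
    exists_mem_nhds_uniformCauchySeqOn_of_isPreconnected hU hUc hf hb ha hC hz
  have hlim (z : ℂ) (hz : z ∈ U) : ∃ y, Tendsto (f · z) p (𝓝 y) := by
    obtain ⟨V, hV, hVC⟩ := hcauchy z hz
    exact cauchy_iff_exists_le_nhds.1 (hVC.cauchy_map (mem_of_mem_nhds hV))
  choose! g hg using hlim
  refine ⟨g, tendstoLocallyUniformlyOn_of_forall_exists_nhds fun z hz => ?_⟩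
  obtain ⟨V, hV, hVC⟩ := hcauchy z hz
  exact ⟨V ∩ U, inter_mem (mem_nhdsWithin_of_mem_nhds hV) self_mem_nhdsWithin,
    (hVC.mono inter_subset_left).tendstoUniformlyOn_of_tendsto fun w hw => hg w hw.2⟩

end Vitali

/-- The inner term `y + ζ² y / (1 - ζ² x y)` of the fixed point equations. -/
noncomputable def coupling (ζ : ℝ) (x y : ℂ) : ℂ :=
  y + (ζ : ℂ) ^ 2 * y / (1 - (ζ : ℂ) ^ 2 * x * y)

/-- One component of the right hand side of the fixed point equations; `x` is the component being
updated and `y` the other one. -/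
noncomputable def fixedPointStep (ψ ζ : ℝ) (ξ x y : ℂ) : ℂ :=
  -ψ / (ξ + coupling ζ x y)

/-- The right hand side of the fixed point equations, so that their solutions are its fixed
points. -/
noncomputable def fixedPointMap (ψ₁ ψ₂ ζ : ℝ) (ξ : ℂ) (z : ℂ × ℂ) : ℂ × ℂ :=
  (fixedPointStep ψ₁ ζ ξ z.1 z.2, fixedPointStep ψ₂ ζ ξ z.2 z.1)

theorem fixedPointEqs_iff {ψ₁ ψ₂ ζ : ℝ} {ξ z₁ z₂ : ℂ} :
    FixedPointEqs ψ₁ ψ₂ ζ ξ z₁ z₂ ↔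
      z₁ = fixedPointStep ψ₁ ζ ξ z₁ z₂ ∧ z₂ = fixedPointStep ψ₂ ζ ξ z₂ z₁ := by
  have hstep (ψ : ℝ) (x y : ℂ) : fixedPointStep ψ ζ ξ x y =
      ψ * (-ξ - y - (ζ : ℂ) ^ 2 * y / (1 - (ζ : ℂ) ^ 2 * x * y))⁻¹ := by
    rw [fixedPointStep, coupling, neg_div, ← div_neg, div_eq_mul_inv]
    congr 2
    ring
  simp only [FixedPointEqs, hstep, mul_right_comm _ z₂ z₁]

theorem fixedPointEqs_iff_isFixedPt {ψ₁ ψ₂ ζ : ℝ} {ξ : ℂ} {z : ℂ × ℂ} :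
    FixedPointEqs ψ₁ ψ₂ ζ ξ z.1 z.2 ↔ Function.IsFixedPt (fixedPointMap ψ₁ ψ₂ ζ ξ) z := by
  rw [fixedPointEqs_iff, eq_comm, eq_comm (a := z.2), Function.IsFixedPt, Prod.ext_iff]
  rfl

section UpperHalf

variable {ψ ψ₁ ψ₂ ζ : ℝ} {ξ x y : ℂ}

theorem isOpen_upperHalf : IsOpen upperHalf := isOpen_lt continuous_const Complex.continuous_im

theorem isPreconnected_upperHalf : IsPreconnected upperHalf :=
  (convex_halfSpace_im_gt 0).isPreconnected

theorem ne_zero_of_mem_upperHalf (hx : x ∈ upperHalf) : x ≠ 0 := by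
  rintro rfl
  exact lt_irrefl (0 : ℝ) hx

theorem im_mul_sub_inv_pos (ζ : ℝ) (hx : x ∈ upperHalf) (hy : y ∈ upperHalf) :
    0 < ((ζ : ℂ) ^ 2 * x - y⁻¹).im := by
  have hy0 : 0 < Complex.normSq y := Complex.normSq_pos.2 (ne_zero_of_mem_upperHalf hy)
  have hx : 0 < x.im := hx
  have hy : 0 < y.im := hy
  rw [Complex.sub_im, ← Complex.ofReal_pow, Complex.im_ofReal_mul, Complex.inv_im, neg_div,
    sub_neg_eq_add]
  positivity

theorem one_sub_sq_mul_mul_eq (hy : y ≠ 0) :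
    1 - (ζ : ℂ) ^ 2 * x * y = -y * ((ζ : ℂ) ^ 2 * x - y⁻¹) := by
  field_simp
  ring

theorem one_sub_sq_mul_mul_ne_zero (ζ : ℝ) (hx : x ∈ upperHalf) (hy : y ∈ upperHalf) :
    1 - (ζ : ℂ) ^ 2 * x * y ≠ 0 := by
  have h := im_mul_sub_inv_pos ζ hx hy
  have hy0 := ne_zero_of_mem_upperHalf hy
  rw [one_sub_sq_mul_mul_eq hy0]
  exact mul_ne_zero (neg_ne_zero.2 hy0) fun h0 => by simp [h0] at h

theorem im_coupling_pos (ζ : ℝ) (hx : x ∈ upperHalf) (hy : y ∈ upperHalf) :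
    0 < (coupling ζ x y).im := by
  have hy0 := ne_zero_of_mem_upperHalf hy
  have h := im_mul_sub_inv_pos ζ hx hy
  have hy' : 0 < y.im := hy
  -- `y / (1 - ζ² x y) = -1 / (ζ² x - 1 / y)`, and `w ↦ -1 / w` preserves the upper half plane.
  rw [coupling, one_sub_sq_mul_mul_eq hy0, neg_mul, div_neg, mul_div_assoc,
    div_mul_cancel_left₀ hy0, Complex.add_im, Complex.neg_im, ← Complex.ofReal_pow,
    Complex.im_ofReal_mul, Complex.inv_im, Complex.ofReal_pow, neg_div, mul_neg, neg_neg]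
  have := Complex.normSq_nonneg ((ζ : ℂ) ^ 2 * x - y⁻¹)
  positivity

theorem im_lt_im_add_coupling (ζ : ℝ) (hx : x ∈ upperHalf) (hy : y ∈ upperHalf) :
    ξ.im < (ξ + coupling ζ x y).im := by
  rw [Complex.add_im]
  exact lt_add_of_pos_right _ (im_coupling_pos ζ hx hy)

theorem neg_div_mem_upperHalf (hψ : 0 < ψ) (hx : x ∈ upperHalf) : -ψ / x ∈ upperHalf := by
  have hx0 : 0 < Complex.normSq x := Complex.normSq_pos.2 (ne_zero_of_mem_upperHalf hx)
  have hx' : 0 < x.im := hx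
  change 0 < (-ψ / x).im
  rw [neg_div, Complex.neg_im, div_eq_mul_inv, Complex.im_ofReal_mul, Complex.inv_im, neg_div,
    mul_neg, neg_neg]
  positivity

/-- The closed disc of diameter `d` that lies in the closed upper half plane and is tangent to the
real axis at `0`. It is the image of `{w | ψ / d ≤ w.im}` under `w ↦ -ψ / w`, together with `0`. -/
def horodisc (d : ℝ) : Set ℂ := {z | ‖z‖ ^ 2 ≤ d * z.im}

theorem isClosed_horodisc (d : ℝ) : IsClosed (horodisc d) :=
  isClosed_le (by fun_prop) (by fun_prop)

theorem norm_le_of_mem_horodisc {d : ℝ} (hd : 0 ≤ d) (hx : x ∈ horodisc d) : ‖x‖ ≤ d := by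
  have him : d * x.im ≤ d * ‖x‖ := mul_le_mul_of_nonneg_left (Complex.im_le_norm x) hd
  have hx' : ‖x‖ ^ 2 ≤ d * x.im := hx
  nlinarith [norm_nonneg x]

theorem mem_upperHalf_of_mem_horodisc {d : ℝ} (hd : 0 ≤ d) (hx : x ∈ horodisc d) (hx0 : x ≠ 0) :
    x ∈ upperHalf :=
  pos_of_mul_pos_right ((pow_pos (norm_pos_iff.2 hx0) 2).trans_le hx) hd

theorem neg_div_mem_horodisc {t : ℝ} (ht : 0 < t) (hx : t ≤ x.im) : -ψ / x ∈ horodisc (ψ / t) := by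
  have hx0 : 0 < Complex.normSq x :=
    Complex.normSq_pos.2 (ne_zero_of_mem_upperHalf (ht.trans_le hx))
  change ‖-ψ / x‖ ^ 2 ≤ ψ / t * (-ψ / x).im
  rw [← Complex.normSq_eq_norm_sq, neg_div, Complex.normSq_neg, Complex.normSq_div,
    Complex.normSq_ofReal, Complex.neg_im, div_eq_mul_inv (ψ : ℂ), Complex.im_ofReal_mul,
    Complex.inv_im]
  calc ψ * ψ / Complex.normSq x = ψ * ψ / Complex.normSq x * 1 := (mul_one _).symm
    _ ≤ ψ * ψ / Complex.normSq x * (x.im / t) := by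
      have := mul_self_nonneg ψ
      have := (one_le_div ht).2 hx
      gcongr
    _ = ψ / t * -(ψ * (-x.im / Complex.normSq x)) := by ring

theorem fixedPointStep_mem_upperHalf (hψ : 0 < ψ) (hξ : ξ ∈ upperHalf) (hx : x ∈ upperHalf)
    (hy : y ∈ upperHalf) : fixedPointStep ψ ζ ξ x y ∈ upperHalf :=
  neg_div_mem_upperHalf hψ (hξ.trans (im_lt_im_add_coupling ζ hx hy))

theorem fixedPointStep_mem_horodisc (hξ : ξ ∈ upperHalf) (hx : x ∈ upperHalf)
    (hy : y ∈ upperHalf) : fixedPointStep ψ ζ ξ x y ∈ horodisc (ψ / ξ.im) :=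
  neg_div_mem_horodisc hξ (im_lt_im_add_coupling ζ hx hy).le

theorem differentiableOn_fixedPointStep {x y : ℂ → ℂ} {s : Set ℂ} (hs : s ⊆ upperHalf)
    (hx : DifferentiableOn ℂ x s) (hy : DifferentiableOn ℂ y s) (hxs : MapsTo x s upperHalf)
    (hys : MapsTo y s upperHalf) :
    DifferentiableOn ℂ (fun ξ => fixedPointStep ψ ζ ξ (x ξ) (y ξ)) s := by
  refine (differentiableOn_const _).div (differentiableOn_id.add (hy.add
    ((hy.const_mul _).div (((hx.const_mul _).mul hy).const_sub 1) fun ξ hξ => ?_))) fun ξ hξ => ?_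
  · exact one_sub_sq_mul_mul_ne_zero ζ (hxs hξ) (hys hξ)
  · exact ne_zero_of_mem_upperHalf ((hs hξ).trans (im_lt_im_add_coupling ζ (hxs hξ) (hys hξ)))

theorem continuousAt_coupling (h : 1 - (ζ : ℂ) ^ 2 * x * y ≠ 0) :
    ContinuousAt (fun z : ℂ × ℂ => coupling ζ z.1 z.2) (x, y) :=
  continuousAt_snd.add ((continuousAt_const.mul continuousAt_snd).div
    (continuousAt_const.sub ((continuousAt_const.mul continuousAt_fst).mul continuousAt_snd)) h)

theorem continuousAt_fixedPointStep (hξ : ξ ∈ upperHalf) (hx : x ∈ upperHalf)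
    (hy : y ∈ upperHalf) : ContinuousAt (fun z : ℂ × ℂ => fixedPointStep ψ ζ ξ z.1 z.2) (x, y) :=
  continuousAt_const.div
    (continuousAt_const.add (continuousAt_coupling (one_sub_sq_mul_mul_ne_zero ζ hx hy)))
    (ne_zero_of_mem_upperHalf (hξ.trans (im_lt_im_add_coupling ζ hx hy)))

theorem continuousAt_fixedPointMap {z : ℂ × ℂ} (hξ : ξ ∈ upperHalf)
    (hz : z ∈ upperHalf ×ˢ upperHalf) : ContinuousAt (fixedPointMap ψ₁ ψ₂ ζ ξ) z :=
  (continuousAt_fixedPointStep hξ hz.1 hz.2).prodMk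
    ((continuousAt_fixedPointStep hξ hz.2 hz.1).comp (f := Prod.swap) continuous_swap.continuousAt)

theorem fixedPointStep_mul (hξ : ξ ∈ upperHalf) (hx : x ∈ upperHalf) (hy : y ∈ upperHalf) :
    fixedPointStep ψ ζ ξ x y * (ξ + coupling ζ x y) = -ψ :=
  div_mul_cancel₀ _ (ne_zero_of_mem_upperHalf (hξ.trans (im_lt_im_add_coupling ζ hx hy)))

end UpperHalf

section Iterates

variable {ψ ψ₁ ψ₂ ζ : ℝ} {ξ : ℂ}

/-- The `n`-th Picard iterate of the fixed point equations, started from the value of the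
right hand side at `(0, 0)`. -/
noncomputable def nuApprox (ψ₁ ψ₂ ζ : ℝ) (n : ℕ) (ξ : ℂ) : ℂ × ℂ :=
  (fixedPointMap ψ₁ ψ₂ ζ ξ)^[n] (-ψ₁ / ξ, -ψ₂ / ξ)

theorem nuApprox_succ (ψ₁ ψ₂ ζ : ℝ) (n : ℕ) (ξ : ℂ) :
    nuApprox ψ₁ ψ₂ ζ (n + 1) ξ = fixedPointMap ψ₁ ψ₂ ζ ξ (nuApprox ψ₁ ψ₂ ζ n ξ) :=
  Function.iterate_succ_apply' _ _ _

theorem nuApprox_mem_upperHalf (h₁ : 0 < ψ₁) (h₂ : 0 < ψ₂) (ζ : ℝ) (hξ : ξ ∈ upperHalf) (n : ℕ) :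
    nuApprox ψ₁ ψ₂ ζ n ξ ∈ upperHalf ×ˢ upperHalf := by
  induction n with
  | zero => exact ⟨neg_div_mem_upperHalf h₁ hξ, neg_div_mem_upperHalf h₂ hξ⟩
  | succ n ih =>
    rw [nuApprox_succ]
    exact ⟨fixedPointStep_mem_upperHalf h₁ hξ ih.1 ih.2,
      fixedPointStep_mem_upperHalf h₂ hξ ih.2 ih.1⟩

theorem nuApprox_mem_horodisc (h₁ : 0 < ψ₁) (h₂ : 0 < ψ₂) (ζ : ℝ) (hξ : ξ ∈ upperHalf) (n : ℕ) :
    nuApprox ψ₁ ψ₂ ζ n ξ ∈ horodisc (ψ₁ / ξ.im) ×ˢ horodisc (ψ₂ / ξ.im) := by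
  cases n with
  | zero => exact ⟨neg_div_mem_horodisc hξ le_rfl, neg_div_mem_horodisc hξ le_rfl⟩
  | succ n =>
    rw [nuApprox_succ]
    have h := nuApprox_mem_upperHalf h₁ h₂ ζ hξ n
    exact ⟨fixedPointStep_mem_horodisc hξ h.1 h.2, fixedPointStep_mem_horodisc hξ h.2 h.1⟩

theorem norm_le_add_div_of_norm_le {z : ℂ × ℂ} (h₁ : 0 ≤ ψ₁) (h₂ : 0 ≤ ψ₂) {t : ℝ} (ht : 0 ≤ t)
    (hz₁ : ‖z.1‖ ≤ ψ₁ / t) (hz₂ : ‖z.2‖ ≤ ψ₂ / t) : ‖z‖ ≤ (ψ₁ + ψ₂) / t := by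
  rw [add_div]
  exact max_le (hz₁.trans (le_add_of_nonneg_right (div_nonneg h₂ ht)))
    (hz₂.trans (le_add_of_nonneg_left (div_nonneg h₁ ht)))

theorem norm_nuApprox_le (h₁ : 0 < ψ₁) (h₂ : 0 < ψ₂) (ζ : ℝ) (hξ : ξ ∈ upperHalf) (n : ℕ) :
    ‖nuApprox ψ₁ ψ₂ ζ n ξ‖ ≤ (ψ₁ + ψ₂) / ξ.im := by
  have hξ' : 0 ≤ ξ.im := le_of_lt hξ
  obtain ⟨hz₁, hz₂⟩ := nuApprox_mem_horodisc h₁ h₂ ζ hξ n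
  exact norm_le_add_div_of_norm_le h₁.le h₂.le hξ' (norm_le_of_mem_horodisc (by positivity) hz₁)
    (norm_le_of_mem_horodisc (by positivity) hz₂)

theorem differentiableOn_nuApprox (h₁ : 0 < ψ₁) (h₂ : 0 < ψ₂) (ζ : ℝ) (n : ℕ) :
    DifferentiableOn ℂ (nuApprox ψ₁ ψ₂ ζ n) upperHalf := by
  induction n with
  | zero =>
    have hdiv (ψ : ℝ) : DifferentiableOn ℂ (fun ξ : ℂ => -ψ / ξ) upperHalf :=
      (differentiableOn_const _).div differentiableOn_id fun ξ hξ => ne_zero_of_mem_upperHalf hξ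
    exact (hdiv ψ₁).prodMk (hdiv ψ₂)
  | succ n ih =>
    simp only [funext (nuApprox_succ ψ₁ ψ₂ ζ n)]
    have hmem (ξ : ℂ) (hξ : ξ ∈ upperHalf) := nuApprox_mem_upperHalf h₁ h₂ ζ hξ n
    have hfst : MapsTo (fun ξ => (nuApprox ψ₁ ψ₂ ζ n ξ).1) upperHalf upperHalf :=
      fun ξ hξ => (hmem ξ hξ).1
    have hsnd : MapsTo (fun ξ => (nuApprox ψ₁ ψ₂ ζ n ξ).2) upperHalf upperHalf :=
      fun ξ hξ => (hmem ξ hξ).2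
    exact (differentiableOn_fixedPointStep subset_rfl ih.fst ih.snd hfst hsnd).prodMk
      (differentiableOn_fixedPointStep subset_rfl ih.snd ih.fst hsnd hfst)

theorem ne_zero_of_tendsto_of_eq_fixedPointStep {x y : ℕ → ℂ} {X Y : ℂ} (hψ : ψ ≠ 0)
    (hξ : ξ ∈ upperHalf) (hx : ∀ n, x n ∈ upperHalf) (hy : ∀ n, y n ∈ upperHalf)
    (hX : Tendsto x atTop (𝓝 X)) (hY : Tendsto y atTop (𝓝 Y))
    (hstep : ∀ n, x (n + 1) = fixedPointStep ψ ζ ξ (x n) (y n)) : X ≠ 0 := by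
  rintro rfl
  have hmul (n : ℕ) : x (n + 1) * (ξ + coupling ζ (x n) (y n)) = -ψ := by
    rw [hstep, fixedPointStep_mul hξ (hx n) (hy n)]
  have hcoupling : Tendsto (fun n => coupling ζ (x n) (y n)) atTop (𝓝 (coupling ζ 0 Y)) :=
    (continuousAt_coupling (by simp)).tendsto.comp (hX.prodMk_nhds hY)
  have hlim := ((tendsto_add_atTop_iff_nat 1).2 hX).mul (hcoupling.const_add ξ)
  simp only [hmul, zero_mul] at hlim
  exact hψ (by simpa using tendsto_nhds_unique tendsto_const_nhds hlim)

theorem mem_horodisc_of_tendsto_nuApprox (h₁ : 0 < ψ₁) (h₂ : 0 < ψ₂) (hξ : ξ ∈ upperHalf)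
    {z : ℂ × ℂ} (hz : Tendsto (nuApprox ψ₁ ψ₂ ζ · ξ) atTop (𝓝 z)) :
    z ∈ horodisc (ψ₁ / ξ.im) ×ˢ horodisc (ψ₂ / ξ.im) :=
  ((isClosed_horodisc _).prod (isClosed_horodisc _)).mem_of_tendsto hz
    (.of_forall (nuApprox_mem_horodisc h₁ h₂ ζ hξ))

theorem mem_upperHalf_of_tendsto_nuApprox (h₁ : 0 < ψ₁) (h₂ : 0 < ψ₂) (hξ : ξ ∈ upperHalf)
    {z : ℂ × ℂ} (hz : Tendsto (nuApprox ψ₁ ψ₂ ζ · ξ) atTop (𝓝 z)) :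
    z ∈ upperHalf ×ˢ upperHalf := by
  have hξ' : 0 ≤ ξ.im := le_of_lt hξ
  have hmem := nuApprox_mem_upperHalf h₁ h₂ ζ hξ
  obtain ⟨hz₁, hz₂⟩ := mem_horodisc_of_tendsto_nuApprox h₁ h₂ hξ hz
  have hlim₁ := hz.fst_nhds
  have hlim₂ := hz.snd_nhds
  have hne₁ : z.1 ≠ 0 := ne_zero_of_tendsto_of_eq_fixedPointStep h₁.ne' hξ (fun n => (hmem n).1)
    (fun n => (hmem n).2) hlim₁ hlim₂ fun n => by rw [nuApprox_succ]; rfl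
  have hne₂ : z.2 ≠ 0 := ne_zero_of_tendsto_of_eq_fixedPointStep h₂.ne' hξ (fun n => (hmem n).2)
    (fun n => (hmem n).1) hlim₂ hlim₁ fun n => by rw [nuApprox_succ]; rfl
  exact ⟨mem_upperHalf_of_mem_horodisc (by positivity) hz₁ hne₁,
    mem_upperHalf_of_mem_horodisc (by positivity) hz₂ hne₂⟩

theorem fixedPointEqs_of_tendsto_nuApprox (h₁ : 0 < ψ₁) (h₂ : 0 < ψ₂) (hξ : ξ ∈ upperHalf)
    {z : ℂ × ℂ} (hz : Tendsto (nuApprox ψ₁ ψ₂ ζ · ξ) atTop (𝓝 z)) :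
    FixedPointEqs ψ₁ ψ₂ ζ ξ z.1 z.2 :=
  fixedPointEqs_iff_isFixedPt.2 (isFixedPt_of_tendsto_iterate hz
    (continuousAt_fixedPointMap hξ (mem_upperHalf_of_tendsto_nuApprox h₁ h₂ hξ hz)))

end Iterates

section Contraction

variable {ψ ψ₁ ψ₂ ζ : ℝ} {ξ x y x' y' : ℂ}

/-- The radius of a polydisc around `0` on which the right hand side of the fixed point equations
is a contraction once `ξ.im` is large. It is chosen so that `|ζ² x y| ≤ 1 / 2` there. -/
noncomputable def contractionRadius (ζ : ℝ) : ℝ := (1 + 2 * ζ ^ 2)⁻¹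

theorem contractionRadius_le_one (ζ : ℝ) : contractionRadius ζ ≤ 1 :=
  inv_le_one_of_one_le₀ (le_add_of_nonneg_right (by positivity))

theorem contractionRadius_nonneg (ζ : ℝ) : 0 ≤ contractionRadius ζ := by
  unfold contractionRadius
  positivity

theorem sq_mul_contractionRadius_le (ζ : ℝ) : ζ ^ 2 * contractionRadius ζ ≤ 1 / 2 := by
  rw [contractionRadius, ← div_eq_mul_inv, div_le_iff₀ (by positivity)]
  linarith

theorem norm_sq_mul_mul_le_half (hx : ‖x‖ ≤ contractionRadius ζ) (hy : ‖y‖ ≤ contractionRadius ζ) :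
    ‖(ζ : ℂ) ^ 2 * x * y‖ ≤ 1 / 2 := by
  rw [norm_mul, norm_mul, norm_pow, Complex.norm_real, Real.norm_eq_abs, sq_abs]
  calc ζ ^ 2 * ‖x‖ * ‖y‖ ≤ ζ ^ 2 * contractionRadius ζ * 1 := by
        have := hy.trans (contractionRadius_le_one ζ)
        have := contractionRadius_nonneg ζ
        gcongr
    _ ≤ 1 / 2 := by rw [mul_one]; exact sq_mul_contractionRadius_le ζ

theorem half_le_norm_one_sub_sq_mul_mul (hx : ‖x‖ ≤ contractionRadius ζ)
    (hy : ‖y‖ ≤ contractionRadius ζ) : 1 / 2 ≤ ‖1 - (ζ : ℂ) ^ 2 * x * y‖ := by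
  have h := norm_sub_norm_le (1 : ℂ) ((ζ : ℂ) ^ 2 * x * y)
  rw [norm_one] at h
  linarith [norm_sq_mul_mul_le_half hx hy]

theorem coupling_sub_coupling (h : 1 - (ζ : ℂ) ^ 2 * x * y ≠ 0)
    (h' : 1 - (ζ : ℂ) ^ 2 * x' * y' ≠ 0) :
    coupling ζ x y - coupling ζ x' y' =
      (y - y') + (ζ : ℂ) ^ 2 * (((y - y') + (ζ : ℂ) ^ 2 * y * y' * (x - x')) /
        ((1 - (ζ : ℂ) ^ 2 * x * y) * (1 - (ζ : ℂ) ^ 2 * x' * y'))) := by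
  rw [coupling, coupling, add_sub_add_comm, div_sub_div _ _ h h']
  ring

theorem norm_coupling_sub_le (hx : ‖x‖ ≤ contractionRadius ζ) (hy : ‖y‖ ≤ contractionRadius ζ)
    (hx' : ‖x'‖ ≤ contractionRadius ζ) (hy' : ‖y'‖ ≤ contractionRadius ζ) :
    ‖coupling ζ x y - coupling ζ x' y'‖ ≤ (1 + 6 * ζ ^ 2) * ‖(x, y) - (x', y')‖ := by
  set δ := ‖(x, y) - (x', y')‖
  have hδx : ‖x - x'‖ ≤ δ := le_max_left _ _
  have hδy : ‖y - y'‖ ≤ δ := le_max_right _ _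
  have hD := half_le_norm_one_sub_sq_mul_mul hx hy
  have hD' := half_le_norm_one_sub_sq_mul_mul hx' hy'
  have hnum : ‖(y - y') + (ζ : ℂ) ^ 2 * y * y' * (x - x')‖ ≤ 3 / 2 * δ := by
    refine (norm_add_le _ _).trans ?_
    rw [norm_mul]
    have := mul_le_mul (norm_sq_mul_mul_le_half hy hy') hδx (norm_nonneg _) (by norm_num)
    linarith
  have hden : 1 / 4 ≤ ‖(1 - (ζ : ℂ) ^ 2 * x * y) * (1 - (ζ : ℂ) ^ 2 * x' * y')‖ := by
    rw [norm_mul]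
    nlinarith
  calc ‖coupling ζ x y - coupling ζ x' y'‖ ≤ δ + ζ ^ 2 * (3 / 2 * δ / (1 / 4)) := by
        rw [coupling_sub_coupling (norm_pos_iff.1 (by linarith)) (norm_pos_iff.1 (by linarith))]
        refine (norm_add_le _ _).trans (add_le_add hδy ?_)
        rw [norm_mul, norm_pow, Complex.norm_real, Real.norm_eq_abs, sq_abs, norm_div]
        gcongr
    _ = (1 + 6 * ζ ^ 2) * δ := by ring

theorem norm_coupling_le_two (hx : ‖x‖ ≤ contractionRadius ζ) (hy : ‖y‖ ≤ contractionRadius ζ) :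
    ‖coupling ζ x y‖ ≤ 2 := by
  have hD := half_le_norm_one_sub_sq_mul_mul hx hy
  have hr := sq_mul_contractionRadius_le ζ
  calc ‖coupling ζ x y‖ ≤ ‖y‖ + ‖(ζ : ℂ) ^ 2 * y / (1 - (ζ : ℂ) ^ 2 * x * y)‖ := norm_add_le _ _
    _ ≤ 1 + ζ ^ 2 * contractionRadius ζ / (1 / 2) := by
      rw [norm_div, norm_mul, norm_pow, Complex.norm_real, Real.norm_eq_abs, sq_abs]
      have := hy.trans (contractionRadius_le_one ζ)
      have := contractionRadius_nonneg ζ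
      gcongr
    _ ≤ 2 := by linarith

/-- A lower bound for `ξ.im` above which the right hand side of the fixed point equations is a
contraction on the polydisc of radius `contractionRadius ζ`. -/
noncomputable def contractionHeight (ψ₁ ψ₂ ζ : ℝ) : ℝ := 8 * (1 + ψ₁ + ψ₂) * (1 + 6 * ζ ^ 2)

theorem contractionHeight_comm (ψ₁ ψ₂ ζ : ℝ) :
    contractionHeight ψ₁ ψ₂ ζ = contractionHeight ψ₂ ψ₁ ζ := by
  unfold contractionHeight
  ring

theorem contractionHeight_pos (h₁ : 0 ≤ ψ₁) (h₂ : 0 ≤ ψ₂) (ζ : ℝ) :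
    0 < contractionHeight ψ₁ ψ₂ ζ := by
  unfold contractionHeight
  positivity

theorem half_im_le_norm_add_coupling (hξ : 4 ≤ ξ.im) (hx : ‖x‖ ≤ contractionRadius ζ)
    (hy : ‖y‖ ≤ contractionRadius ζ) : ξ.im / 2 ≤ ‖ξ + coupling ζ x y‖ := by
  have h := norm_sub_le_norm_add ξ (coupling ζ x y)
  linarith [norm_coupling_le_two hx hy, Complex.im_le_norm ξ]

theorem norm_fixedPointStep_sub_le (h₁ : 0 ≤ ψ₁) (h₂ : 0 ≤ ψ₂)
    (hξ : contractionHeight ψ₁ ψ₂ ζ ≤ ξ.im) (hx : ‖x‖ ≤ contractionRadius ζ)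
    (hy : ‖y‖ ≤ contractionRadius ζ) (hx' : ‖x'‖ ≤ contractionRadius ζ)
    (hy' : ‖y'‖ ≤ contractionRadius ζ) :
    ‖fixedPointStep ψ₁ ζ ξ x y - fixedPointStep ψ₁ ζ ξ x' y'‖ ≤
      1 / 2 * ‖(x, y) - (x', y')‖ := by
  set δ := ‖(x, y) - (x', y')‖
  have hL : 1 ≤ 1 + 6 * ζ ^ 2 := le_add_of_nonneg_right (by positivity)
  have him : 8 + ψ₁ * (1 + 6 * ζ ^ 2) ≤ ξ.im := by
    rw [contractionHeight] at hξ
    nlinarith [mul_nonneg h₁ (zero_le_one.trans hL), mul_nonneg h₂ (zero_le_one.trans hL)]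
  have hψL : 0 ≤ ψ₁ * (1 + 6 * ζ ^ 2) := by positivity
  have ha := half_im_le_norm_add_coupling (by linarith) hx hy
  have ha' := half_im_le_norm_add_coupling (by linarith) hx' hy'
  have hsub : fixedPointStep ψ₁ ζ ξ x y - fixedPointStep ψ₁ ζ ξ x' y' =
      ψ₁ * (coupling ζ x y - coupling ζ x' y') /
        ((ξ + coupling ζ x y) * (ξ + coupling ζ x' y')) := by
    have ha0 : ξ + coupling ζ x y ≠ 0 := norm_pos_iff.1 (by linarith)
    have ha0' : ξ + coupling ζ x' y' ≠ 0 := norm_pos_iff.1 (by linarith)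
    rw [fixedPointStep, fixedPointStep, div_sub_div _ _ ha0 ha0']
    ring
  rw [hsub, norm_div, norm_mul, norm_mul, Complex.norm_real, Real.norm_of_nonneg h₁]
  calc ψ₁ * ‖coupling ζ x y - coupling ζ x' y'‖ /
        (‖ξ + coupling ζ x y‖ * ‖ξ + coupling ζ x' y'‖)
      ≤ ψ₁ * ((1 + 6 * ζ ^ 2) * δ) / (ξ.im / 2 * (ξ.im / 2)) := by
        have := norm_coupling_sub_le hx hy hx' hy'
        have : 0 < ξ.im := by linarith
        gcongr
    _ = ψ₁ * (1 + 6 * ζ ^ 2) / (ξ.im / 2 * (ξ.im / 2)) * δ := by ring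
    _ ≤ 1 / 2 * δ := by
        have : ψ₁ * (1 + 6 * ζ ^ 2) / (ξ.im / 2 * (ξ.im / 2)) ≤ 1 / 2 := by
          rw [div_le_iff₀ (by nlinarith)]
          nlinarith
        gcongr

theorem norm_fixedPointMap_sub_le {z w : ℂ × ℂ} (h₁ : 0 ≤ ψ₁) (h₂ : 0 ≤ ψ₂)
    (hξ : contractionHeight ψ₁ ψ₂ ζ ≤ ξ.im) (hz : ‖z‖ ≤ contractionRadius ζ)
    (hw : ‖w‖ ≤ contractionRadius ζ) :
    ‖fixedPointMap ψ₁ ψ₂ ζ ξ z - fixedPointMap ψ₁ ψ₂ ζ ξ w‖ ≤ 1 / 2 * ‖z - w‖ := by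
  obtain ⟨hz₁, hz₂⟩ := max_le_iff.1 hz
  obtain ⟨hw₁, hw₂⟩ := max_le_iff.1 hw
  refine max_le (norm_fixedPointStep_sub_le h₁ h₂ hξ hz₁ hz₂ hw₁ hw₂) ?_
  refine (norm_fixedPointStep_sub_le h₂ h₁ (contractionHeight_comm ψ₁ ψ₂ ζ ▸ hξ)
    hz₂ hz₁ hw₂ hw₁).trans_eq ?_
  rw [← Prod.swap_prod_mk, ← Prod.swap_prod_mk, Prod.norm_def, Prod.norm_def, max_comm]
  rfl

theorem add_div_im_le_contractionRadius (h₁ : 0 ≤ ψ₁) (h₂ : 0 ≤ ψ₂)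
    (hξ : contractionHeight ψ₁ ψ₂ ζ ≤ ξ.im) : (ψ₁ + ψ₂) / ξ.im ≤ contractionRadius ζ := by
  rw [contractionRadius, ← one_div,
    div_le_div_iff₀ ((contractionHeight_pos h₁ h₂ ζ).trans_le hξ) (by positivity), one_mul]
  refine le_trans ?_ hξ
  rw [contractionHeight]
  gcongr
  all_goals nlinarith [sq_nonneg ζ]

theorem FixedPointEqs.eq_of_norm_le {z w : ℂ × ℂ} (h₁ : 0 ≤ ψ₁) (h₂ : 0 ≤ ψ₂)
    (hξ : contractionHeight ψ₁ ψ₂ ζ ≤ ξ.im) (hz : FixedPointEqs ψ₁ ψ₂ ζ ξ z.1 z.2)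
    (hw : FixedPointEqs ψ₁ ψ₂ ζ ξ w.1 w.2) (hz_le : ‖z‖ ≤ contractionRadius ζ)
    (hw_le : ‖w‖ ≤ contractionRadius ζ) : z = w := by
  have h := norm_fixedPointMap_sub_le h₁ h₂ hξ hz_le hw_le
  rw [fixedPointEqs_iff_isFixedPt.1 hz, fixedPointEqs_iff_isFixedPt.1 hw] at h
  exact sub_eq_zero.1 (norm_le_zero_iff.1 (by linarith))

theorem norm_nuApprox_add_sub_le (h₁ : 0 < ψ₁) (h₂ : 0 < ψ₂)
    (hξ : contractionHeight ψ₁ ψ₂ ζ ≤ ξ.im) (N m n : ℕ) :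
    ‖nuApprox ψ₁ ψ₂ ζ (m + N) ξ - nuApprox ψ₁ ψ₂ ζ (n + N) ξ‖ ≤ (1 / 2) ^ N * 2 := by
  have hξ' : ξ ∈ upperHalf := (contractionHeight_pos h₁.le h₂.le ζ).trans_le hξ
  have hle (k : ℕ) : ‖nuApprox ψ₁ ψ₂ ζ k ξ‖ ≤ contractionRadius ζ :=
    (norm_nuApprox_le h₁ h₂ ζ hξ' k).trans (add_div_im_le_contractionRadius h₁.le h₂.le hξ)
  induction N with
  | zero =>
    rw [add_zero, add_zero, pow_zero]
    linarith [norm_sub_le (nuApprox ψ₁ ψ₂ ζ m ξ) (nuApprox ψ₁ ψ₂ ζ n ξ), hle m, hle n,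
      contractionRadius_le_one ζ]
  | succ N ih =>
    rw [← add_assoc, ← add_assoc, nuApprox_succ, nuApprox_succ, pow_succ', mul_assoc]
    exact (norm_fixedPointMap_sub_le h₁.le h₂.le hξ (hle _) (hle _)).trans (by gcongr)

theorem uniformCauchySeqOn_nuApprox (h₁ : 0 < ψ₁) (h₂ : 0 < ψ₂) (ζ : ℝ) :
    UniformCauchySeqOn (nuApprox ψ₁ ψ₂ ζ) atTop {ξ | contractionHeight ψ₁ ψ₂ ζ < ξ.im} := by
  refine Metric.uniformCauchySeqOn_iff.2 fun ε hε => ?_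
  obtain ⟨N, hN⟩ := exists_pow_lt_of_lt_one (half_pos hε) (one_half_lt_one (α := ℝ))
  refine ⟨N, fun m hm n hn ξ hξ => ?_⟩
  obtain ⟨m, rfl⟩ := Nat.exists_eq_add_of_le' hm
  obtain ⟨n, rfl⟩ := Nat.exists_eq_add_of_le' hn
  rw [dist_eq_norm]
  exact (norm_nuApprox_add_sub_le h₁ h₂ (le_of_lt hξ) N m n).trans_lt (by linarith)

end Contraction

section NuPair

variable {ψ₁ ψ₂ ζ : ℝ} {ν ν' : (ℂ → ℂ) × (ℂ → ℂ)}

theorem exists_tendstoLocallyUniformlyOn_nuApprox (h₁ : 0 < ψ₁) (h₂ : 0 < ψ₂) (ζ : ℝ) :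
    ∃ g : ℂ → ℂ × ℂ, TendstoLocallyUniformlyOn (nuApprox ψ₁ ψ₂ ζ) g atTop upperHalf := by
  set C := contractionHeight ψ₁ ψ₂ ζ
  have hC : 0 < C := contractionHeight_pos h₁.le h₂.le ζ
  have ha : C < (Complex.I * ((C + 1 : ℝ) : ℂ)).im := by
    rw [Complex.I_mul_im, Complex.ofReal_re]
    exact lt_add_one C
  refine exists_tendstoLocallyUniformlyOn_of_isPreconnected isOpen_upperHalf
    isPreconnected_upperHalf (differentiableOn_nuApprox h₁ h₂ ζ) (fun w hw => ?_) (hC.trans ha)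
    ⟨_, (isOpen_lt continuous_const Complex.continuous_im).mem_nhds ha,
      uniformCauchySeqOn_nuApprox h₁ h₂ ζ⟩
  refine ⟨(ψ₁ + ψ₂) / (w.im / 2), ?_⟩
  have hw' : 0 < w.im / 2 := half_pos hw
  filter_upwards [Complex.continuous_im.continuousAt.eventually_const_lt (half_lt_self hw)]
    with v hv n
  exact (norm_nuApprox_le h₁ h₂ ζ (hw'.trans hv) n).trans (by gcongr)

theorem exists_isNuPair (h₁ : 0 < ψ₁) (h₂ : 0 < ψ₂) (ζ : ℝ) : ∃ ν, IsNuPair ψ₁ ψ₂ ζ ν := by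
  obtain ⟨g, hg⟩ := exists_tendstoLocallyUniformlyOn_nuApprox h₁ h₂ ζ
  have hlim (ξ : ℂ) (hξ : ξ ∈ upperHalf) := hg.tendsto_at hξ
  have hmem (ξ : ℂ) (hξ : ξ ∈ upperHalf) := mem_upperHalf_of_tendsto_nuApprox h₁ h₂ hξ (hlim ξ hξ)
  have heqs (ξ : ℂ) (hξ : ξ ∈ upperHalf) := fixedPointEqs_of_tendsto_nuApprox h₁ h₂ hξ (hlim ξ hξ)
  have hdiff : DifferentiableOn ℂ g upperHalf :=
    hg.differentiableOn (.of_forall (differentiableOn_nuApprox h₁ h₂ ζ)) isOpen_upperHalf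
  have hC := contractionHeight_pos h₁.le h₂.le ζ
  refine ⟨(fun ξ => (g ξ).1, fun ξ => (g ξ).2),
    fun ξ hξ => (hmem ξ hξ).1, fun ξ hξ => (hmem ξ hξ).2,
    hdiff.fst.analyticOnNhd isOpen_upperHalf, hdiff.snd.analyticOnNhd isOpen_upperHalf, heqs,
    contractionHeight ψ₁ ψ₂ ζ, hC, fun ξ hξ => ?_⟩
  have hξ₀ : 0 < ξ.im := hC.trans hξ
  obtain ⟨hd₁, hd₂⟩ := mem_horodisc_of_tendsto_nuApprox h₁ h₂ hξ₀ (hlim ξ hξ₀)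
  have hb₁ : ‖(g ξ).1‖ ≤ ψ₁ / ξ.im := norm_le_of_mem_horodisc (by positivity) hd₁
  have hb₂ : ‖(g ξ).2‖ ≤ ψ₂ / ξ.im := norm_le_of_mem_horodisc (by positivity) hd₂
  have hr {z : ℂ × ℂ} (hz₁ : ‖z.1‖ ≤ ψ₁ / ξ.im) (hz₂ : ‖z.2‖ ≤ ψ₂ / ξ.im) :
      ‖z‖ ≤ contractionRadius ζ :=
    (norm_le_add_div_of_norm_le h₁.le h₂.le hξ₀.le hz₁ hz₂).trans
      (add_div_im_le_contractionRadius h₁.le h₂.le hξ.le)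
  exact ⟨⟨hb₁, hb₂⟩, fun z₁ z₂ hz hz₁ hz₂ => Prod.ext_iff.1
    (FixedPointEqs.eq_of_norm_le (z := (z₁, z₂)) h₁.le h₂.le hξ.le hz (heqs ξ hξ₀)
      (hr hz₁ hz₂) (hr hb₁ hb₂))⟩

theorem isNuPair_nuPair (h₁ : 0 < ψ₁) (h₂ : 0 < ψ₂) (ζ : ℝ) :
    IsNuPair ψ₁ ψ₂ ζ (nuPair ψ₁ ψ₂ ζ) :=
  Classical.epsilon_spec (exists_isNuPair h₁ h₂ ζ)

theorem FixedPointEqs.swap {ξ z₁ z₂ : ℂ} (h : FixedPointEqs ψ₁ ψ₂ ζ ξ z₁ z₂) :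
    FixedPointEqs ψ₂ ψ₁ ζ ξ z₂ z₁ :=
  fixedPointEqs_iff.2 (fixedPointEqs_iff.1 h).symm

theorem IsNuPair.swap (h : IsNuPair ψ₁ ψ₂ ζ ν) : IsNuPair ψ₂ ψ₁ ζ ν.swap := by
  obtain ⟨C, hC, hlarge⟩ := h.unique_large
  exact ⟨h.mapsTo_snd, h.mapsTo_fst, h.analytic_snd, h.analytic_fst, fun ξ hξ => (h.eqs ξ hξ).swap,
    C, hC, fun ξ hξ => ⟨(hlarge ξ hξ).1.symm, fun z₁ z₂ hz hz₁ hz₂ =>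
      ((hlarge ξ hξ).2 z₂ z₁ hz.swap hz₂ hz₁).symm⟩⟩

theorem IsNuPair.eqOn_fst (h : IsNuPair ψ₁ ψ₂ ζ ν) (h' : IsNuPair ψ₁ ψ₂ ζ ν') :
    EqOn ν'.1 ν.1 upperHalf := by
  obtain ⟨C, hC, hlarge⟩ := h.unique_large
  obtain ⟨C', -, hlarge'⟩ := h'.unique_large
  have heq (ξ : ℂ) (hξ : max C C' < ξ.im) : ν'.1 ξ = ν.1 ξ := by
    obtain ⟨hξC, hξC'⟩ := max_lt_iff.1 hξ
    obtain ⟨⟨hb₁, hb₂⟩, -⟩ := hlarge' ξ hξC'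
    exact ((hlarge ξ hξC).2 _ _ (h'.eqs ξ (hC.trans hξC)) hb₁ hb₂).1
  have ha : max C C' < (Complex.I * ((max C C' + 1 : ℝ) : ℂ)).im := by
    rw [Complex.I_mul_im, Complex.ofReal_re]
    exact lt_add_one _
  refine h'.analytic_fst.eqOn_of_preconnected_of_eventuallyEq h.analytic_fst
    isPreconnected_upperHalf ((hC.trans_le (le_max_left C C')).trans ha) ?_
  filter_upwards [Complex.continuous_im.continuousAt.eventually_const_lt ha] using heq

theorem IsNuPair.eqOn_snd (h : IsNuPair ψ₁ ψ₂ ζ ν) (h' : IsNuPair ψ₁ ψ₂ ζ ν') :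
    EqOn ν'.2 ν.2 upperHalf :=
  h.swap.eqOn_fst h'.swap

/-- The reflection `z ↦ -conj z` of the complex plane in the imaginary axis. -/
noncomputable def negConj (z : ℂ) : ℂ := -starRingEnd ℂ z

theorem negConj_negConj (z : ℂ) : negConj (negConj z) = z := by
  simp only [negConj, map_neg, Complex.conj_conj, neg_neg]

theorem im_negConj (z : ℂ) : (negConj z).im = z.im := by
  rw [negConj, Complex.neg_im, Complex.conj_im, neg_neg]

theorem norm_negConj (z : ℂ) : ‖negConj z‖ = ‖z‖ := by
  rw [negConj, norm_neg, Complex.norm_conj]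

theorem negConj_eq_self_iff {z : ℂ} : negConj z = z ↔ z.re = 0 := by
  rw [Complex.ext_iff, im_negConj, negConj, Complex.neg_re, Complex.conj_re, neg_eq_self]
  exact and_iff_left rfl

theorem negConj_mem_upperHalf {z : ℂ} (hz : z ∈ upperHalf) : negConj z ∈ upperHalf :=
  hz.trans_eq (im_negConj z).symm

theorem analyticOnNhd_negConj {f : ℂ → ℂ} (hf : AnalyticOnNhd ℂ f upperHalf) :
    AnalyticOnNhd ℂ (negConj ∘ f ∘ negConj) upperHalf := by
  refine DifferentiableOn.analyticOnNhd (fun ξ hξ => ?_) isOpen_upperHalf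
  have hconj : DifferentiableAt ℂ (starRingEnd ℂ ∘ f ∘ starRingEnd ℂ) (-ξ) := by
    rw [differentiableAt_conj_conj_iff, map_neg]
    exact (hf _ (negConj_mem_upperHalf hξ)).differentiableAt
  have h := (hconj.comp ξ differentiableAt_id.neg).neg
  simp only [Function.comp_def, map_neg] at h
  exact h.differentiableWithinAt

theorem coupling_negConj (ζ : ℝ) (x y : ℂ) :
    coupling ζ (negConj x) (negConj y) = negConj (coupling ζ x y) := by
  simp only [coupling, negConj, map_add, map_div₀, map_sub, map_mul, map_pow, map_one,
    Complex.conj_ofReal]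
  ring

theorem fixedPointStep_negConj (ψ ζ : ℝ) (ξ x y : ℂ) :
    fixedPointStep ψ ζ (negConj ξ) (negConj x) (negConj y) =
      negConj (fixedPointStep ψ ζ ξ x y) := by
  rw [fixedPointStep, coupling_negConj, fixedPointStep]
  simp only [negConj, map_add, map_div₀, map_neg, Complex.conj_ofReal]
  rw [← neg_add, div_neg]

theorem FixedPointEqs.map_negConj {ξ z₁ z₂ : ℂ} (h : FixedPointEqs ψ₁ ψ₂ ζ ξ z₁ z₂) :
    FixedPointEqs ψ₁ ψ₂ ζ (negConj ξ) (negConj z₁) (negConj z₂) := by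
  rw [fixedPointEqs_iff] at h ⊢
  rw [fixedPointStep_negConj, fixedPointStep_negConj, ← h.1, ← h.2]
  exact ⟨rfl, rfl⟩

theorem IsNuPair.negConj_comp (h : IsNuPair ψ₁ ψ₂ ζ ν) :
    IsNuPair ψ₁ ψ₂ ζ (negConj ∘ ν.1 ∘ negConj, negConj ∘ ν.2 ∘ negConj) := by
  obtain ⟨C, hC, hlarge⟩ := h.unique_large
  refine ⟨fun ξ hξ => negConj_mem_upperHalf (h.mapsTo_fst (negConj_mem_upperHalf hξ)),
    fun ξ hξ => negConj_mem_upperHalf (h.mapsTo_snd (negConj_mem_upperHalf hξ)),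
    analyticOnNhd_negConj h.analytic_fst, analyticOnNhd_negConj h.analytic_snd, fun ξ hξ => ?_,
    C, hC, fun ξ hξ => ?_⟩
  · change FixedPointEqs ψ₁ ψ₂ ζ ξ (negConj (ν.1 (negConj ξ))) (negConj (ν.2 (negConj ξ)))
    simpa only [negConj_negConj] using (h.eqs _ (negConj_mem_upperHalf hξ)).map_negConj
  · have hlarge' := hlarge (negConj ξ)
    simp only [im_negConj] at hlarge'
    obtain ⟨hb, huniq⟩ := hlarge' hξ
    simp only [Function.comp_apply, norm_negConj]
    refine ⟨hb, fun z₁ z₂ hz hz₁ hz₂ => ?_⟩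
    obtain ⟨he₁, he₂⟩ := huniq _ _ hz.map_negConj ((norm_negConj z₁).trans_le hz₁)
      ((norm_negConj z₂).trans_le hz₂)
    rw [← he₁, ← he₂, negConj_negConj, negConj_negConj]
    exact ⟨rfl, rfl⟩

theorem IsNuPair.re_fst_eq_zero (h : IsNuPair ψ₁ ψ₂ ζ ν) {ξ : ℂ} (hξ : ξ ∈ upperHalf)
    (hre : ξ.re = 0) : (ν.1 ξ).re = 0 := by
  have heq : negConj (ν.1 (negConj ξ)) = ν.1 ξ := h.eqOn_fst h.negConj_comp hξ
  rwa [negConj_eq_self_iff.2 hre, negConj_eq_self_iff] at heq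

end NuPair

section ImaginaryAxis

variable {ψ₁ ψ₂ ζ s : ℝ} {ν : (ℂ → ℂ) × (ℂ → ℂ)}

theorem I_mul_mem_upperHalf (hs : 0 < s) : Complex.I * s ∈ upperHalf :=
  hs.trans_eq (Complex.I_mul_im s).symm

theorem IsNuPair.fst_I_mul (h : IsNuPair ψ₁ ψ₂ ζ ν) (hs : 0 < s) :
    ν.1 (Complex.I * s) = Complex.I * (ν.1 (Complex.I * s)).im := by
  have hre := h.re_fst_eq_zero (I_mul_mem_upperHalf hs) (by simp)
  rw [Complex.ext_iff, hre, Complex.I_mul_re, Complex.I_mul_im, Complex.ofReal_im,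
    Complex.ofReal_re, neg_zero]
  exact ⟨rfl, rfl⟩

theorem coupling_I_mul (ζ p r : ℝ) :
    coupling ζ (Complex.I * p) (Complex.I * r) =
      Complex.I * ((r + ζ ^ 2 * r / (1 + ζ ^ 2 * (p * r)) : ℝ) : ℂ) := by
  have hden : 1 - (ζ : ℂ) ^ 2 * (Complex.I * p) * (Complex.I * r) = 1 + ζ ^ 2 * (p * r) := by
    linear_combination (-(ζ : ℂ) ^ 2 * p * r) * Complex.I_sq
  rw [coupling, hden]
  push_cast
  ring

/-- The product of the imaginary parts of `ν₁` and `ν₂` at the point `i s`. As both functions are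
purely imaginary there, this is `-ν₁ ν₂`. -/
noncomputable def axisProduct (ν : (ℂ → ℂ) × (ℂ → ℂ)) (s : ℝ) : ℝ :=
  (ν.1 (Complex.I * s)).im * (ν.2 (Complex.I * s)).im

theorem axisProduct_swap (ν : (ℂ → ℂ) × (ℂ → ℂ)) (s : ℝ) :
    axisProduct ν.swap s = axisProduct ν s :=
  mul_comm _ _

theorem IsNuPair.mul_eq_neg_axisProduct (h : IsNuPair ψ₁ ψ₂ ζ ν) (hs : 0 < s) :
    ν.1 (Complex.I * s) * ν.2 (Complex.I * s) = -(axisProduct ν s : ℂ) := by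
  have hsnd : ν.2 (Complex.I * s) = Complex.I * (ν.2 (Complex.I * s)).im := h.swap.fst_I_mul hs
  rw [h.fst_I_mul hs, hsnd, axisProduct, Complex.ofReal_mul, mul_mul_mul_comm, Complex.I_mul_I,
    neg_one_mul]

theorem IsNuPair.axisProduct_pos (h : IsNuPair ψ₁ ψ₂ ζ ν) (hs : 0 < s) : 0 < axisProduct ν s :=
  mul_pos (h.mapsTo_fst (I_mul_mem_upperHalf hs)) (h.mapsTo_snd (I_mul_mem_upperHalf hs))

/-- On the imaginary axis the fixed point equations read
`s * (νᵢ (i s)).im = ψᵢ - productShift ζ (axisProduct ν s)`. -/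
noncomputable def productShift (ζ q : ℝ) : ℝ := q + ζ ^ 2 * q / (1 + ζ ^ 2 * q)

theorem strictMonoOn_productShift (ζ : ℝ) : StrictMonoOn (productShift ζ) (Ici 0) := by
  intro q hq q' hq' hlt
  have hq : 0 ≤ q := hq
  have hq' : 0 ≤ q' := hq'
  refine add_lt_add_of_lt_of_le hlt ?_
  rw [div_le_div_iff₀ (by positivity) (by positivity)]
  nlinarith [mul_le_mul_of_nonneg_left hlt.le (sq_nonneg ζ)]

theorem IsNuPair.mul_im_fst (h : IsNuPair ψ₁ ψ₂ ζ ν) (hs : 0 < s) :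
    s * (ν.1 (Complex.I * s)).im = ψ₁ - productShift ζ (axisProduct ν s) := by
  have hξ := I_mul_mem_upperHalf hs
  have hstep := fixedPointStep_mul (ψ := ψ₁) (ζ := ζ) hξ (h.mapsTo_fst hξ) (h.mapsTo_snd hξ)
  have hsnd : ν.2 (Complex.I * s) = Complex.I * (ν.2 (Complex.I * s)).im := h.swap.fst_I_mul hs
  rw [← (fixedPointEqs_iff.1 (h.eqs _ hξ)).1, h.fst_I_mul hs, hsnd, coupling_I_mul] at hstep
  rw [axisProduct]
  set p := (ν.1 (Complex.I * s)).im
  set r := (ν.2 (Complex.I * s)).im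
  have hreal : -(p * (s + (r + ζ ^ 2 * r / (1 + ζ ^ 2 * (p * r))))) = -ψ₁ := by
    rw [← mul_add, mul_mul_mul_comm, Complex.I_mul_I] at hstep
    rw [← neg_one_mul]
    exact_mod_cast hstep
  rw [productShift, mul_div_assoc, ← neg_inj.1 hreal]
  ring

theorem IsNuPair.im_fst_lt_of_axisProduct_lt (h : IsNuPair ψ₁ ψ₂ ζ ν) {s' : ℝ} (hs : 0 < s)
    (hss' : s ≤ s') (hlt : axisProduct ν s < axisProduct ν s') :
    (ν.1 (Complex.I * s')).im < (ν.1 (Complex.I * s)).im := by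
  have hs' : 0 < s' := hs.trans_le hss'
  have hp' : 0 < (ν.1 (Complex.I * s')).im := h.mapsTo_fst (I_mul_mem_upperHalf hs')
  have hshift := strictMonoOn_productShift ζ (h.axisProduct_pos hs).le (h.axisProduct_pos hs').le
    hlt
  refine lt_of_mul_lt_mul_left ?_ hs.le
  calc s * (ν.1 (Complex.I * s')).im ≤ s' * (ν.1 (Complex.I * s')).im := by gcongr
    _ < s * (ν.1 (Complex.I * s)).im := by
      rw [h.mul_im_fst hs, h.mul_im_fst hs']
      exact sub_lt_sub_left hshift _

theorem IsNuPair.antitoneOn_axisProduct (h : IsNuPair ψ₁ ψ₂ ζ ν) :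
    AntitoneOn (axisProduct ν) (Ioi 0) := by
  intro s hs s' hs' hss'
  by_contra! hlt
  have hfst := h.im_fst_lt_of_axisProduct_lt hs hss' hlt
  have hsnd : (ν.2 (Complex.I * s')).im < (ν.2 (Complex.I * s)).im :=
    h.swap.im_fst_lt_of_axisProduct_lt hs hss' (by rwa [axisProduct_swap, axisProduct_swap])
  have hp : 0 < (ν.1 (Complex.I * s)).im := h.mapsTo_fst (I_mul_mem_upperHalf hs)
  have hr' : 0 < (ν.2 (Complex.I * s')).im := h.mapsTo_snd (I_mul_mem_upperHalf hs')
  exact hlt.not_ge (mul_le_mul hfst.le hsnd.le hr'.le hp.le)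

end ImaginaryAxis

section LimitPPV

variable {μ₁ μs F₁ Fs τ ψ₁ ψ₂ lam : ℝ}

/-- The number `|χ| = -χ`. -/
noncomputable def chiAbs (μ₁ μs ψ₁ ψ₂ lam : ℝ) : ℝ :=
  axisProduct (nuPair ψ₁ ψ₂ (μ₁ / μs)) (Real.sqrt (ψ₁ * ψ₂ * lam) / μs)

theorem sqrt_mul_div_pos (hμs : 0 < μs) (h₁ : 0 < ψ₁) (h₂ : 0 < ψ₂) (hlam : 0 < lam) :
    0 < Real.sqrt (ψ₁ * ψ₂ * lam) / μs := by
  positivity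

theorem chi_eq_neg_chiAbs (μ₁ : ℝ) (hμs : 0 < μs) (h₁ : 0 < ψ₁) (h₂ : 0 < ψ₂) (hlam : 0 < lam) :
    chi μ₁ μs ψ₁ ψ₂ lam = -(chiAbs μ₁ μs ψ₁ ψ₂ lam : ℂ) :=
  (isNuPair_nuPair h₁ h₂ _).mul_eq_neg_axisProduct (sqrt_mul_div_pos hμs h₁ h₂ hlam)

theorem chiAbs_pos (μ₁ : ℝ) (hμs : 0 < μs) (h₁ : 0 < ψ₁) (h₂ : 0 < ψ₂) (hlam : 0 < lam) :
    0 < chiAbs μ₁ μs ψ₁ ψ₂ lam :=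
  (isNuPair_nuPair h₁ h₂ _).axisProduct_pos (sqrt_mul_div_pos hμs h₁ h₂ hlam)

theorem antitoneOn_chiAbs (μ₁ : ℝ) (hμs : 0 < μs) (h₁ : 0 < ψ₁) (h₂ : 0 < ψ₂) :
    AntitoneOn (chiAbs μ₁ μs ψ₁ ψ₂) (Ioi 0) := fun lam hlam lam' hlam' hle =>
  (isNuPair_nuPair h₁ h₂ _).antitoneOn_axisProduct (sqrt_mul_div_pos hμs h₁ h₂ hlam)
    (sqrt_mul_div_pos hμs h₁ h₂ hlam') (by gcongr)

theorem one_sub_chi_mul_eq (μ₁ : ℝ) (hμs : 0 < μs) (h₁ : 0 < ψ₁) (h₂ : 0 < ψ₂)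
    (hlam : 0 < lam) : 1 - chi μ₁ μs ψ₁ ψ₂ lam * ((μ₁ / μs : ℝ) : ℂ) ^ 2 =
      ((1 + chiAbs μ₁ μs ψ₁ ψ₂ lam * (μ₁ / μs) ^ 2 : ℝ) : ℂ) := by
  rw [chi_eq_neg_chiAbs μ₁ hμs h₁ h₂ hlam, neg_mul, sub_neg_eq_add]
  push_cast
  rfl

theorem one_sub_chi_mul_ne_zero (μ₁ : ℝ) (hμs : 0 < μs) (h₁ : 0 < ψ₁) (h₂ : 0 < ψ₂)
    (hlam : 0 < lam) : 1 - chi μ₁ μs ψ₁ ψ₂ lam * ((μ₁ / μs : ℝ) : ℂ) ^ 2 ≠ 0 := by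
  have hpos := chiAbs_pos μ₁ hμs h₁ h₂ hlam
  rw [one_sub_chi_mul_eq μ₁ hμs h₁ h₂ hlam, Complex.ofReal_ne_zero]
  positivity

theorem limitPPVComplex_eq_ofReal (μ₁ F₁ Fs τ : ℝ) (hμs : 0 < μs) (h₁ : 0 < ψ₁) (h₂ : 0 < ψ₂)
    (hlam : 0 < lam) : limitPPVComplex μ₁ μs F₁ Fs τ ψ₁ ψ₂ lam =
      ((F₁ ^ 2 / (1 + chiAbs μ₁ μs ψ₁ ψ₂ lam * (μ₁ / μs) ^ 2) + Fs ^ 2 + τ ^ 2 : ℝ) : ℂ) := by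
  rw [limitPPVComplex, one_sub_chi_mul_eq μ₁ hμs h₁ h₂ hlam]
  norm_cast

theorem limitPPV_eq (μ₁ F₁ Fs τ : ℝ) (hμs : 0 < μs) (h₁ : 0 < ψ₁) (h₂ : 0 < ψ₂)
    (hlam : 0 < lam) : limitPPV μ₁ μs F₁ Fs τ ψ₁ ψ₂ lam =
      F₁ ^ 2 / (1 + chiAbs μ₁ μs ψ₁ ψ₂ lam * (μ₁ / μs) ^ 2) + Fs ^ 2 + τ ^ 2 := by
  rw [limitPPV, limitPPVComplex_eq_ofReal μ₁ F₁ Fs τ hμs h₁ h₂ hlam, Complex.ofReal_re]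

theorem ofReal_limitPPV (μ₁ F₁ Fs τ : ℝ) (hμs : 0 < μs) (h₁ : 0 < ψ₁) (h₂ : 0 < ψ₂)
    (hlam : 0 < lam) :
    (limitPPV μ₁ μs F₁ Fs τ ψ₁ ψ₂ lam : ℂ) = limitPPVComplex μ₁ μs F₁ Fs τ ψ₁ ψ₂ lam := by
  rw [limitPPV_eq μ₁ F₁ Fs τ hμs h₁ h₂ hlam, limitPPVComplex_eq_ofReal μ₁ F₁ Fs τ hμs h₁ h₂ hlam]

theorem monotoneOn_limitPPV (μ₁ F₁ Fs τ : ℝ) (hμs : 0 < μs) (h₁ : 0 < ψ₁) (h₂ : 0 < ψ₂) :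
    MonotoneOn (limitPPV μ₁ μs F₁ Fs τ ψ₁ ψ₂) (Ioi 0) := by
  intro lam hlam lam' hlam' hle
  rw [limitPPV_eq μ₁ F₁ Fs τ hμs h₁ h₂ hlam, limitPPV_eq μ₁ F₁ Fs τ hμs h₁ h₂ hlam']
  have hpos := chiAbs_pos μ₁ hμs h₁ h₂ hlam'
  have hchi := antitoneOn_chiAbs μ₁ hμs h₁ h₂ hlam hlam' hle
  gcongr

theorem exists_tendsto_limitPPV (μ₁ F₁ Fs τ : ℝ) (hμs : 0 < μs) (h₁ : 0 < ψ₁) (h₂ : 0 < ψ₂) :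
    ∃ L, Tendsto (limitPPV μ₁ μs F₁ Fs τ ψ₁ ψ₂) (𝓝[>] 0) (𝓝 L) := by
  refine ⟨_, (monotoneOn_limitPPV μ₁ F₁ Fs τ hμs h₁ h₂).tendsto_nhdsGT ⟨0, ?_⟩⟩
  rintro _ ⟨lam, hlam, rfl⟩
  have hpos := chiAbs_pos μ₁ hμs h₁ h₂ hlam
  rw [limitPPV_eq μ₁ F₁ Fs τ hμs h₁ h₂ hlam]
  positivity

end LimitPPV

theorem proposition2_general (μ₁ F₁ Fs τ : ℝ) {μs ψ₁ ψ₂ : ℝ} (hμs : 0 < μs) (h₁ : 0 < ψ₁)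
    (h₂ : 0 < ψ₂) :
    ((∃ ν : (ℂ → ℂ) × (ℂ → ℂ), IsNuPair ψ₁ ψ₂ (μ₁ / μs) ν ∧
        ∀ ν' : (ℂ → ℂ) × (ℂ → ℂ), IsNuPair ψ₁ ψ₂ (μ₁ / μs) ν' →
          EqOn ν'.1 ν.1 upperHalf ∧ EqOn ν'.2 ν.2 upperHalf) ∧
      ∀ lam : ℝ, 0 < lam →
        1 - chi μ₁ μs ψ₁ ψ₂ lam * ((μ₁ / μs : ℝ) : ℂ) ^ 2 ≠ 0 ∧
        (limitPPV μ₁ μs F₁ Fs τ ψ₁ ψ₂ lam : ℂ) = limitPPVComplex μ₁ μs F₁ Fs τ ψ₁ ψ₂ lam) ∧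
    MonotoneOn (limitPPV μ₁ μs F₁ Fs τ ψ₁ ψ₂) (Ioi 0) ∧
    ∃ L : ℝ, Tendsto (limitPPV μ₁ μs F₁ Fs τ ψ₁ ψ₂) (𝓝[>] 0) (𝓝 L) := by
  have hν := isNuPair_nuPair h₁ h₂ (μ₁ / μs)
  exact ⟨⟨⟨_, hν, fun ν' hν' => ⟨hν.eqOn_fst hν', hν.eqOn_snd hν'⟩⟩, fun lam hlam =>
      ⟨one_sub_chi_mul_ne_zero μ₁ hμs h₁ h₂ hlam, ofReal_limitPPV μ₁ F₁ Fs τ hμs h₁ h₂ hlam⟩⟩,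
    monotoneOn_limitPPV μ₁ F₁ Fs τ hμs h₁ h₂, exists_tendsto_limitPPV μ₁ F₁ Fs τ hμs h₁ h₂⟩

theorem proposition2 (μ₁ μs F₁ Fs τ : ℝ) (hμ₁ : 0 < μ₁) (hμs : 0 < μs) :
    -- the map is well defined: the pair of functions exists and is unique on the upper half plane,
    -- the denominator in the formula does not vanish and the formula gives a real number
    (∀ ψ₁ ψ₂ : ℝ, 0 < ψ₁ → 0 < ψ₂ →
      (∃ ν : (ℂ → ℂ) × (ℂ → ℂ), IsNuPair ψ₁ ψ₂ (μ₁ / μs) ν ∧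
        ∀ ν' : (ℂ → ℂ) × (ℂ → ℂ), IsNuPair ψ₁ ψ₂ (μ₁ / μs) ν' →
          EqOn ν'.1 ν.1 upperHalf ∧ EqOn ν'.2 ν.2 upperHalf) ∧
      ∀ lam : ℝ, 0 < lam →
        1 - chi μ₁ μs ψ₁ ψ₂ lam * ((μ₁ / μs : ℝ) : ℂ) ^ 2 ≠ 0 ∧
        (limitPPV μ₁ μs F₁ Fs τ ψ₁ ψ₂ lam : ℂ) = limitPPVComplex μ₁ μs F₁ Fs τ ψ₁ ψ₂ lam) ∧
    -- it is non-decreasing in the regularization parameter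
    (∀ ψ₁ ψ₂ : ℝ, 0 < ψ₁ → 0 < ψ₂ →
      MonotoneOn (fun lam : ℝ => limitPPV μ₁ μs F₁ Fs τ ψ₁ ψ₂ lam) (Ioi 0)) ∧
    -- for `ψ₁ = ψ₂` it has a finite limit as the regularization parameter decreases to zero
    (∀ ψ₁ ψ₂ : ℝ, 0 < ψ₁ → 0 < ψ₂ → ψ₁ = ψ₂ →
      ∃ L : ℝ, Tendsto (fun lam : ℝ => limitPPV μ₁ μs F₁ Fs τ ψ₁ ψ₂ lam) (𝓝[>] 0) (𝓝 L)) :=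
  have h (ψ₁ ψ₂ : ℝ) (h₁ : 0 < ψ₁) (h₂ : 0 < ψ₂) := proposition2_general μ₁ F₁ Fs τ hμs h₁ h₂
  ⟨fun _ _ h₁ h₂ => (h _ _ h₁ h₂).1, fun _ _ h₁ h₂ => (h _ _ h₁ h₂).2.1,
    fun _ _ h₁ h₂ _ => (h _ _ h₁ h₂).2.2⟩
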